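/- Let $E$ be a Polish space, $d:E\times E\to[0,\infty)$ a metric on $E$ that is lower semicontinuous for the topology of $E\times E$ (it need not induce the topology of $E$), $1\le p\le 2$, $q\in[2,\infty]$ with $1/p+1/q=1$, $C>0$, and $P$ a Borel probability measure on $E$. Write $\mu[h]=\int h\,d\mu$, let $M^+(E)$ be the set of lower semicontinuous functions $\alpha:E\to[0,\infty)$, $\mathcal C_b$ the set of bounded continuous functions $f:E\to\mathbb R$, and $$f_{\alpha,d}(y)=\inf_{x\in E}\{\alpha(y)d(x,y)+f(x)\}.$$ For probability measures $Q,R$ on $E$ put $$\tilde W_{p,d}(Q,R)=\sup_{\alpha\in M^+(E)}\ \inf_{\pi}\ \frac{\pi[\alpha(Y)d(X,Y)]}{R[\alpha^q]^{1/q}},$$ where $\pi$ runs over the laws of pairs $(X,Y)$ with $X\sim Q$, $Y\sim R$, where $R[\alpha^q]^{1/q}$ is the $R$-essential supremum of $\alpha$ if $q=\infty$, and where $+\infty/+\infty=0/0=0$. Say that $P$ satisfies $\tilde T_{p,d}(C)$ if $\tilde W_{p,d}(P,Q)\le\sqrt{2C\,\mathcal K(Q|P)}$ for all probability measures $Q$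 on $E$, and $\tilde T^{(i)}_{p,d}(C)$ if $\tilde W_{p,d}(Q,P)\le\sqrt{2C\,\mathcal K(Q|P)}$ for all $Q$, where $\mathcal K(Q|P)=Q[\log(dQ/dP)]$ is the relative entropy ($+\infty$ if $Q\not\ll P$). Then: (1) $P$ satisfies $\tilde T_{p,d}(C)$ if and only if $$\sup_{\lambda>0}\ \sup_{\alpha\in M^+(E)}\ \sup_{f\in\mathcal C_b}\ P\Big[\exp\Big(\lambda\,(f_{\alpha,d}-P[f])-C\lambda^2\Big(\frac{\alpha^q-1}{q}+\frac12\Big)\Big)\Big]\le 1;$$ (2) $P$ satisfies $\tilde T^{(i)}_{p,d}(C)$ if and only if $$\sup_{\lambda>0}\ \sup_{\alpha\in M^+(E)}\ \sup_{f\in\mathcal C_b}\ P\Big[\exp\Big(\lambda\,(P[f_{\alpha,d}]-f)-C\lambda^2\Big(\frac{P[\alpha^q]-1}{q}+\frac12\Big)\Big)\Big]\le 1.$$ Here $\exp(-\infty)=0$, and for $p=1$, $q=\infty$ one reads $1/q=0$ and $a^q/q=0$ if $a\le1$, $a^q/q=+\infty$ if $a>1$; correspondingly $P[\alpha^q]/q=P[\alpha^q/q]$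 is $0$ if $\alpha\le1$ $P$-almost everywhere and $+\infty$ otherwise. -/

import Mathlib

open MeasureTheory Set
open scoped ENNReal NNReal BoundedContinuousFunction

noncomputable section

namespace WeakTransport

variable {E : Type*}

/-- `d` is a metric on the set `E`; it need not induce the topology of `E`. -/
structure IsMetric (d : E → E → ℝ) : Prop where
  nonneg : ∀ x y, 0 ≤ d x y
  eq_zero_iff : ∀ x y, d x y = 0 ↔ x = y
  symm : ∀ x y, d x y = d y x
  triangle : ∀ x y z, d x z ≤ d x y + d y z

/-- The couplings of `P` and `Q`: the measures on `E × E` with first marginal `P` and second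
marginal `Q`. -/
def couplings [MeasurableSpace E] (P Q : Measure E) : Set (Measure (E × E)) :=
  {π | π.fst = P ∧ π.snd = Q}

/-- The weak transport cost, with `q` the conjugate exponent of `p`:
`sup_α inf_π π[α(Y) d(X, Y)] / Q[α ^ q] ^ (1 / q)`, over lower semicontinuous `α ≥ 0` and couplings
`π` of `P` and `Q`. `eLpNorm α q Q` is `Q[α ^ q] ^ (1 / q)`, and the essential supremum of `α`
under `Q` if `q = ∞`. Division in `ℝ≥0∞` obeys `0 / 0 = 0` and `∞ / ∞ = 0`. -/
def weakCost [TopologicalSpace E] [MeasurableSpace E] (q : ℝ≥0∞) (d : E → E → ℝ)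
    (P Q : Measure E) : ℝ≥0∞ :=
  ⨆ (α : E → ℝ≥0) (_ : LowerSemicontinuous α), ⨅ π ∈ couplings P Q,
    (∫⁻ z, (α z.2 : ℝ≥0∞) * ENNReal.ofReal (d z.1 z.2) ∂π) /
      eLpNorm (fun y => (α y : ℝ)) q Q

/-- The weak transport inequality: for every probability measure `Q`,
`weakCost P Q ≤ √(2 C K(Q | P))`. -/
def WeakTransportIneq [TopologicalSpace E] [MeasurableSpace E] (q : ℝ≥0∞) (d : E → E → ℝ)
    (C : ℝ) (P : Measure E) : Prop :=
  ∀ Q : Measure E, IsProbabilityMeasure Q →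
    weakCost q d P Q ≤ (2 * ENNReal.ofReal C * InformationTheory.klDiv Q P) ^ (1 / 2 : ℝ)

/-- The inverted weak transport inequality: for every probability measure `Q`,
`weakCost Q P ≤ √(2 C K(Q | P))`. -/
def InvWeakTransportIneq [TopologicalSpace E] [MeasurableSpace E] (q : ℝ≥0∞) (d : E → E → ℝ)
    (C : ℝ) (P : Measure E) : Prop :=
  ∀ Q : Measure E, IsProbabilityMeasure Q →
    weakCost q d Q P ≤ (2 * ENNReal.ofReal C * InformationTheory.klDiv Q P) ^ (1 / 2 : ℝ)

/-- `f_{α,d}(y) = inf_x (α(y) d(x, y) + f(x))`. -/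
def infConv (α : E → ℝ≥0) (d : E → E → ℝ) (f : E → ℝ) (y : E) : ℝ :=
  ⨅ x : E, ((α y : ℝ) * d x y + f x)

/-- `a ^ q / q`; for `q = ∞` its limit, which is `0` if `a ≤ 1` and `∞` if
`a > 1`. -/
def powDiv (q a : ℝ≥0∞) : ℝ≥0∞ :=
  open scoped Classical in
  if q = ∞ then (if a ≤ 1 then 0 else ∞) else a ^ q.toReal / q

/-- The exponential inequality
`P[exp(λ (f_{α,d} - P[f]) - C λ² ((α ^ q - 1) / q + 1 / 2))] ≤ 1` for all `λ > 0`, all lower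
semicontinuous `α ≥ 0` and all bounded continuous `f`. -/
def DualForm [TopologicalSpace E] [MeasurableSpace E] (q : ℝ≥0∞) (d : E → E → ℝ)
    (C : ℝ) (P : Measure E) : Prop :=
  ∀ l : ℝ, 0 < l → ∀ α : E → ℝ≥0, LowerSemicontinuous α → ∀ f : E →ᵇ ℝ,
    ∫⁻ y, EReal.exp (((l * (infConv α d f y - ∫ x, f x ∂P) : ℝ) : EReal) -
      ((C * l ^ 2 : ℝ) : EReal) *
        ((powDiv q (α y) : EReal) - ((q⁻¹ : ℝ≥0∞) : EReal) + ((1 / 2 : ℝ) : EReal))) ∂P ≤ 1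

/-- The exponential inequality
`P[exp(λ (P[f_{α,d}] - f) - C λ² ((P[α ^ q] - 1) / q + 1 / 2))] ≤ 1` for all `λ > 0`, all lower
semicontinuous `α ≥ 0` and all bounded continuous `f`. -/
def InvDualForm [TopologicalSpace E] [MeasurableSpace E] (q : ℝ≥0∞) (d : E → E → ℝ)
    (C : ℝ) (P : Measure E) : Prop :=
  ∀ l : ℝ, 0 < l → ∀ α : E → ℝ≥0, LowerSemicontinuous α → ∀ f : E →ᵇ ℝ,
    ∫⁻ x, EReal.exp (((l * ((∫ y, infConv α d f y ∂P) - f x) : ℝ) : EReal) -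
      ((C * l ^ 2 : ℝ) : EReal) *
        (((∫⁻ y, powDiv q (α y) ∂P : ℝ≥0∞) : EReal) - ((q⁻¹ : ℝ≥0∞) : EReal) +
          ((1 / 2 : ℝ) : EReal))) ∂P ≤ 1

end WeakTransport

end

/-!
Both parts are the same convex duality, applied to the transport cost from `P` to `Q` in the first
and from `Q` to `P` in the second.

For fixed `α`, the infimum over the couplings of two measures `R` and `S` is an optimal transport cost with the lower
semicontinuous cost `c(x, y) = α(y) d(x, y)`. Kantorovich duality
(`exists_coupling_lintegral_le`, `ofReal_infConv_sub_le_lintegral`) identifies it with the supremum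
of `S[f_{α,d}] - R[f]` over bounded continuous `f`. The denominator `N = S[α ^ q] ^ (1 / q)` and the
square root are then linearized: `s N ≤ s² / (2 C l) + C l N² / 2` for all `l > 0`, while
`N² / 2 ≤ (S[α ^ q] - 1) / q + 1 / 2` because `q ≥ 2`, with equality when `N = 1`, a normalization
that scaling `α` allows. With `{R, S} = {P, Q}` and `s² = 2 C K(Q | P)`, the transport
inequality thus says that, for all `l`, `α` and `f`, an expression affine in the measure `Q` is at
most `K(Q | P)` (`weakCost_le_iff`). Gibbs' variational principle
`log P[exp φ] = sup_Q (Q[φ] - K(Q | P))` (`integral_toReal_le_toReal_klDiv`,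
`lintegral_exp_le_one`) turns that family of inequalities over `Q` into the exponential inequality.

Two ingredients are of independent interest.

* The function `f_{α,d}` is an infimum over uncountably many points, so it need not be Borel. Its
  sublevel sets are projections of Borel sets, hence analytic, hence measurable for the completion
  of every finite measure (`nullMeasurableSet_of_analyticSet`).
* Kantorovich duality is obtained by embedding the Polish space `E` into a compact metric space `K`
  and applying the Riesz extension theorem to the positive functionals on `C(K × K)` with the
  prescribed marginals; the coupling is the representing measure, and it lives on `E × E` because
  its marginals live on `E`. Approximating the cost from below by continuous functions on `K × K`
  bounds its integral.
-/

namespace WeakTransport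

open Filter Topology InformationTheory

/-! ### Universal measurability of analytic sets and of infimal convolutions -/

section Measurability

lemma isCompact_box (b : ℕ → ℕ) : IsCompact {x : ℕ → ℕ | ∀ i, x i ≤ b i} := by
  have : {x : ℕ → ℕ | ∀ i, x i ≤ b i} = Set.pi univ fun i => Iic (b i) := by
    ext; simp [Pi.le_def]
  rw [this]
  exact isCompact_univ_pi fun i => (finite_Iic (b i)).isCompact

/-- An open set of `ℕ → ℕ` containing a box `∏ [0, b i]` contains a cylinder
`{x | ∀ i < k, x i ≤ b i}` over it. -/
lemma exists_cylinder_subset_of_box_subset {b : ℕ → ℕ} {O : Set (ℕ → ℕ)} (hO : IsOpen O)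
    (hbO : {x : ℕ → ℕ | ∀ i, x i ≤ b i} ⊆ O) :
    ∃ k, {x : ℕ → ℕ | ∀ i < k, x i ≤ b i} ⊆ O := by
  by_contra! h
  choose x hx hxO using fun k => not_subset.1 (h k)
  -- truncating `x k` puts it into the box without changing its first `k` coordinates
  obtain ⟨y, hy, φ, hφ, hlim⟩ := (isCompact_box b).tendsto_subseq
    (x := fun k i => min (x k i) (b i)) (fun k i => min_le_right _ _)
  have hlim' : Tendsto (fun n => x (φ n)) atTop (𝓝 y) := by
    rw [tendsto_pi_nhds] at hlim ⊢
    intro i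
    refine (hlim i).congr' ?_
    filter_upwards [hφ.tendsto_atTop.eventually_gt_atTop i] with n hn
    exact min_eq_left (hx (φ n) i hn)
  obtain ⟨n, hn⟩ := (hlim'.eventually (hO.mem_nhds (hbO hy))).exists
  exact hxO _ hn

/-- Analytic sets are capacitable: their measure is approximated from inside by compact sets.
Bounding the coordinates of `ℕ → ℕ` one after the other, each bound large enough to keep the measure
of the image above `a`, leaves a compact box. -/
lemma exists_isCompact_image_measure_ge {α : Type*} [TopologicalSpace α] [PolishSpace α]
    [MeasurableSpace α] [BorelSpace α] (μ : Measure α) [IsFiniteMeasure μ]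
    {f : (ℕ → ℕ) → α} (hf : Continuous f) {a : ℝ≥0∞} (ha : a < μ (range f)) :
    ∃ K, IsCompact K ∧ K ⊆ range f ∧ a ≤ μ K := by
  have step : ∀ (B : Set (ℕ → ℕ)) (k : ℕ), a < μ (f '' B) →
      ∃ n, a < μ (f '' (B ∩ {x | x k ≤ n})) := by
    intro B k hB
    have hU : f '' B = ⋃ n, f '' (B ∩ {x | x k ≤ n}) := by
      rw [← image_iUnion, ← inter_iUnion]
      congr 1
      ext x
      simp only [mem_inter_iff, mem_iUnion, mem_ofPred_eq]
      exact ⟨fun h => ⟨h, x k, le_rfl⟩, fun h => h.1⟩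
    have hmono : Monotone fun n => f '' (B ∩ {x | x k ≤ n}) := fun m n hmn =>
      image_mono (inter_subset_inter_right _ fun x (hx : x k ≤ m) => hx.trans hmn)
    rw [hU, hmono.measure_iUnion] at hB
    exact lt_iSup_iff.1 hB
  choose! N hN using step
  let B : ℕ → Set (ℕ → ℕ) := fun k => Nat.rec univ (fun k B => B ∩ {x | x k ≤ N B k}) k
  have hB : ∀ k, a < μ (f '' B k) := by
    intro k
    induction k with
    | zero => simpa [B] using ha
    | succ k ih => exact hN _ _ ih
  let b : ℕ → ℕ := fun k => N (B k) k
  have hBb : ∀ k, B k = {x | ∀ i < k, x i ≤ b i} := by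
    intro k
    induction k with
    | zero => simp [B]
    | succ k ih =>
      change B k ∩ {x | x k ≤ b k} = _
      rw [ih]
      ext x
      exact Nat.forall_lt_succ_right.symm
  refine ⟨f '' {x | ∀ i, x i ≤ b i}, (isCompact_box b).image hf, image_subset_range _ _, ?_⟩
  let := TopologicalSpace.upgradeIsCompletelyMetrizable α
  rw [Set.measure_eq_iInf_isOpen]
  refine le_iInf₂ fun V hV => le_iInf fun hVo => ?_
  obtain ⟨k, hk⟩ := exists_cylinder_subset_of_box_subset (hVo.preimage hf) (image_subset_iff.1 hV)
  exact (hB k).le.trans (measure_mono (image_subset_iff.2 (hBb k ▸ hk)))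

/-- Analytic subsets of a Polish space are universally measurable. -/
theorem nullMeasurableSet_of_analyticSet {α : Type*} [TopologicalSpace α] [PolishSpace α]
    [MeasurableSpace α] [BorelSpace α] (μ : Measure α) [IsFiniteMeasure μ] {s : Set α}
    (hs : AnalyticSet s) : NullMeasurableSet s μ := by
  rw [AnalyticSet] at hs
  rcases hs with rfl | ⟨f, hf, rfl⟩
  · exact MeasurableSet.empty.nullMeasurableSet
  rcases eq_or_ne (μ (range f)) 0 with h0 | h0
  · exact NullMeasurableSet.of_null h0
  obtain ⟨u, -, hu, hlim⟩ := exists_seq_strictMono_tendsto' (pos_iff_ne_zero.2 h0)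
  choose K hKc hKs hK using fun n => exists_isCompact_image_measure_ge μ hf (hu n).2
  have hm : MeasurableSet (⋃ n, K n) := MeasurableSet.iUnion fun n => (hKc n).measurableSet
  have hle : μ (range f) ≤ μ (⋃ n, K n) :=
    le_of_tendsto' hlim fun n => (hK n).trans (measure_mono (subset_iUnion K n))
  exact hm.nullMeasurableSet.congr (ae_eq_of_subset_of_measure_ge (iUnion_subset hKs) hle
    hm.nullMeasurableSet (measure_ne_top _ _))

variable {E : Type*}

lemma bddBelow_infConv {α : E → ℝ≥0} {d : E → E → ℝ} (hd : ∀ x y, 0 ≤ d x y) {f : E → ℝ} {m : ℝ}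
    (hm : ∀ x, m ≤ f x) (y : E) : BddBelow (range fun x => (α y : ℝ) * d x y + f x) :=
  ⟨m, by rintro _ ⟨x, rfl⟩; have := mul_nonneg (α y).coe_nonneg (hd x y); linarith [hm x]⟩

/-- The infimal convolution is measurable for the completion of every finite measure: its strict
sublevel sets are projections of Borel sets, hence analytic. -/
lemma aemeasurable_infConv [TopologicalSpace E] [PolishSpace E] [MeasurableSpace E] [BorelSpace E]
    {d : E → E → ℝ} (hd : ∀ x y, 0 ≤ d x y) (hdm : Measurable fun z : E × E => d z.1 z.2)
    {α : E → ℝ≥0} (hα : Measurable α) (f : E →ᵇ ℝ) (μ : Measure E) [IsFiniteMeasure μ] :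
    AEMeasurable (infConv α d f) μ := by
  rcases isEmpty_or_nonempty E with hE | hE
  · exact Subsingleton.aemeasurable
  refine NullMeasurable.aemeasurable
    (measurable_of_Iio (f := (infConv α d f : NullMeasurableSpace E μ → ℝ)) fun t => ?_)
  change NullMeasurableSet (infConv α d f ⁻¹' Iio t) μ
  have hset : infConv α d f ⁻¹' Iio t =
      Prod.snd '' {z : E × E | (α z.2 : ℝ) * d z.1 z.2 + f z.1 < t} := by
    ext y
    simp only [mem_preimage, mem_Iio, mem_image, mem_ofPred_eq, Prod.exists, exists_eq_right,
      infConv]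
    exact ciInf_lt_iff (bddBelow_infConv hd (fun x => (abs_le.1 (f.norm_coe_le_norm x)).1) y)
  rw [hset]
  refine nullMeasurableSet_of_analyticSet μ
    (AnalyticSet.image_of_continuous ?_ continuous_snd)
  refine MeasurableSet.analyticSet (measurableSet_lt ?_ measurable_const)
  exact ((hα.comp measurable_snd).coe_nnreal_real.mul hdm).add
    (f.continuous.measurable.comp measurable_fst)

end Measurability

/-! ### Kantorovich duality for lower semicontinuous costs -/

section Kantorovich

/-- A lower semicontinuous function `c ≥ 0` on a subspace of a compact metric space is a pointwise
limit of continuous functions of the ambient space that lie below it: the Lipschitz regularizations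
`z ↦ inf_w (c w + n dist(z, w))`. -/
lemma exists_seq_continuousMap_tendsto {X Z : Type*} [TopologicalSpace X] [MetricSpace Z]
    {j : X → Z} (hj : IsInducing j) {c : X → ℝ} (hc0 : ∀ x, 0 ≤ c x)
    (hc : LowerSemicontinuous c) :
    ∃ h : ℕ → C(Z, ℝ), (∀ n x, h n (j x) ≤ c x) ∧
      ∀ x, Tendsto (fun n => h n (j x)) atTop (𝓝 (c x)) := by
  rcases isEmpty_or_nonempty X with hX | hX
  · exact ⟨0, fun _ x => hX.elim x, fun x => hX.elim x⟩
  let H : ℕ → Z → ℝ := fun n z => ⨅ w, (c w + n * dist z (j w))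
  have hbdd : ∀ (n : ℕ) z, BddBelow (range fun w => c w + n * dist z (j w)) := fun n z =>
    ⟨0, by rintro _ ⟨w, rfl⟩; exact add_nonneg (hc0 w) (by positivity)⟩
  have hlip : ∀ n : ℕ, LipschitzWith n (H n) := fun n => by
    refine LipschitzWith.of_le_add_mul _ fun z z' => ?_
    rw [← sub_le_iff_le_add]
    refine le_ciInf fun w => ?_
    rw [sub_le_iff_le_add]
    refine (ciInf_le (hbdd n z) w).trans ?_
    have := mul_le_mul_of_nonneg_left (dist_triangle z z' (j w)) (Nat.cast_nonneg (α := ℝ) n)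
    simp only [NNReal.coe_natCast]
    linarith
  have hle : ∀ n x, H n (j x) ≤ c x := fun n x => by
    simpa using ciInf_le (hbdd n (j x)) x
  refine ⟨fun n => ⟨H n, (hlip n).continuous⟩, hle, fun x => ?_⟩
  refine tendsto_order.2 ⟨fun a ha => ?_, fun a ha => Eventually.of_forall fun n =>
    (hle n x).trans_lt ha⟩
  obtain ⟨b, hab, hb⟩ := exists_between ha
  have hnhds : ∀ᶠ w in 𝓝 x, b < c w := hc x b hb
  rw [hj.nhds_eq_comap, (Metric.nhds_basis_ball.comap j).eventually_iff] at hnhds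
  obtain ⟨δ, hδ, hball⟩ := hnhds
  obtain ⟨N, hN⟩ := exists_nat_ge (b / δ)
  filter_upwards [eventually_ge_atTop N] with n hn
  refine hab.trans_le (le_ciInf fun w => ?_)
  have hn0 : (0 : ℝ) ≤ n := Nat.cast_nonneg n
  by_cases hw : dist (j x) (j w) < δ
  · have h1 : b < c w := hball (by simpa [dist_comm] using hw)
    have := mul_nonneg hn0 (dist_nonneg (x := j x) (y := j w))
    linarith
  · have h1 : b ≤ n * δ := (div_le_iff₀ hδ).1 (hN.trans (Nat.cast_le.2 hn))
    have h2 := mul_le_mul_of_nonneg_left (not_lt.1 hw) hn0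
    linarith [hc0 w]

/-- Riesz–Markov–Kakutani on a compact space, for linear functionals on `C(Z, ℝ)`. -/
lemma exists_measure_integral_eq {Z : Type*} [TopologicalSpace Z] [CompactSpace Z] [T2Space Z]
    [MeasurableSpace Z] [BorelSpace Z] (L : C(Z, ℝ) →ₗ[ℝ] ℝ) (hL : ∀ h, 0 ≤ h → 0 ≤ L h) :
    ∃ μ : Measure Z, IsFiniteMeasure μ ∧ ∀ h : C(Z, ℝ), ∫ z, h z ∂μ = L h := by
  let Λ : CompactlySupportedContinuousMap Z ℝ →ₚ[ℝ] ℝ :=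
    { toFun := fun g => L g.toContinuousMap
      map_add' := fun g g' => L.map_add g.toContinuousMap g'.toContinuousMap
      map_smul' := fun a g => L.map_smul a g.toContinuousMap
      monotone' := fun g g' h => by
        have := hL (g'.toContinuousMap - g.toContinuousMap) (fun z => sub_nonneg.2 (h z))
        rw [map_sub] at this
        exact sub_nonneg.1 this }
  refine ⟨RealRMK.rieszMeasure Λ, inferInstance, fun h => ?_⟩
  exact RealRMK.integral_rieszMeasure Λ ⟨h, HasCompactSupport.of_compactSpace _⟩

variable {E : Type*} [TopologicalSpace E] [MeasurableSpace E] [BorelSpace E]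

/-- The functional form of Kantorovich duality. The constraints on the values of a positive
functional on `C(K × K)` with marginals `Q` and `S` and with transport cost at most `T` are
consistent precisely because of the dual bound `h`; the Riesz extension theorem produces it. The
cone is that of the `(u, f, g, t)` with `t ≥ 0` and `u + f ⊕ g + t c ≥ 0` on `E × E`, and the
functional is prescribed on `u = 0`. -/
lemma exists_functional {K : Type*} [TopologicalSpace K] [CompactSpace K] {ι : E → K}
    (hι : Continuous ι) {c : E × E → ℝ} (hc0 : ∀ z, 0 ≤ c z)
    (Q S : Measure E) [IsProbabilityMeasure Q] [IsProbabilityMeasure S] (T : ℝ)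
    (h : ∀ f g : E →ᵇ ℝ, (∀ x y, g y ≤ c (x, y) + f x) → ∫ y, g y ∂S ≤ T + ∫ x, f x ∂Q) :
    ∃ L : C(K × K, ℝ) →ₗ[ℝ] ℝ,
      (∀ u, 0 ≤ u → 0 ≤ L u) ∧
      (∀ f : C(K, ℝ), L (f.comp ⟨Prod.fst, continuous_fst⟩) = ∫ x, f (ι x) ∂Q) ∧
      (∀ g : C(K, ℝ), L (g.comp ⟨Prod.snd, continuous_snd⟩) = ∫ y, g (ι y) ∂S) ∧
      ∀ u : C(K × K, ℝ), (∀ x y, u (ι x, ι y) ≤ c (x, y)) → L u ≤ T := by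
  let b : C(K, ℝ) → (E →ᵇ ℝ) := fun f =>
    (BoundedContinuousFunction.mkOfCompact f).compContinuous ⟨ι, hι⟩
  have hb : ∀ f x, b f x = f (ι x) := fun _ _ => rfl
  have hint : ∀ (μ : Measure E) [IsProbabilityMeasure μ] (f : C(K, ℝ)),
      Integrable (fun x => f (ι x)) μ := fun μ _ f => (b f).integrable μ
  let V := C(K × K, ℝ) × C(K, ℝ) × C(K, ℝ) × ℝ
  let s : PointedCone ℝ V :=
    { carrier := {v | 0 ≤ v.2.2.2 ∧
        ∀ x y, 0 ≤ v.1 (ι x, ι y) + v.2.1 (ι x) + v.2.2.1 (ι y) + v.2.2.2 * c (x, y)}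
      add_mem' := by
        rintro ⟨u, f, g, t⟩ ⟨u', f', g', t'⟩ ⟨hv, hv'⟩ ⟨hw, hw'⟩
        refine ⟨add_nonneg hv hw, fun x y => ?_⟩
        have := add_nonneg (hv' x y) (hw' x y)
        change 0 ≤ (u (ι x, ι y) + u' (ι x, ι y)) + (f (ι x) + f' (ι x)) + (g (ι y) + g' (ι y)) +
          (t + t') * c (x, y)
        linarith
      zero_mem' := ⟨le_rfl, fun x y => by
        change (0 : ℝ) ≤ 0 + 0 + 0 + 0 * c (x, y)
        simp⟩
      smul_mem' := by
        rintro ⟨a, ha⟩ ⟨u, f, g, t⟩ ⟨hv, hv'⟩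
        refine ⟨mul_nonneg ha hv, fun x y => ?_⟩
        have := mul_nonneg ha (hv' x y)
        change 0 ≤ a * u (ι x, ι y) + a * f (ι x) + a * g (ι y) + a * t * c (x, y)
        linarith }
  let F : V →ₗ[ℝ] ℝ :=
    { toFun := fun v => ∫ x, v.2.1 (ι x) ∂Q + ∫ y, v.2.2.1 (ι y) ∂S + v.2.2.2 * T
      map_add' := by
        rintro ⟨u, f, g, t⟩ ⟨u', f', g', t'⟩
        change ∫ x, (f (ι x) + f' (ι x)) ∂Q + ∫ y, (g (ι y) + g' (ι y)) ∂S + (t + t') * T =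
          (∫ x, f (ι x) ∂Q + ∫ y, g (ι y) ∂S + t * T) +
            (∫ x, f' (ι x) ∂Q + ∫ y, g' (ι y) ∂S + t' * T)
        rw [integral_add (hint Q _) (hint Q _), integral_add (hint S _) (hint S _)]
        ring
      map_smul' := by
        rintro a ⟨u, f, g, t⟩
        change ∫ x, a * f (ι x) ∂Q + ∫ y, a * g (ι y) ∂S + a * t * T =
          a * (∫ x, f (ι x) ∂Q + ∫ y, g (ι y) ∂S + t * T)
        rw [integral_const_mul, integral_const_mul]
        ring }
  have hFs : ∀ v : V, v.1 = 0 → v ∈ s → 0 ≤ F v := by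
    rintro ⟨u, f, g, t⟩ hu ⟨ht, hv⟩
    obtain rfl : u = 0 := hu
    simp only [ContinuousMap.zero_apply, zero_add] at ht hv
    change 0 ≤ ∫ x, f (ι x) ∂Q + ∫ y, g (ι y) ∂S + t * T
    rcases ht.eq_or_lt with rfl | ht
    -- without the cost term, `f(x) ≥ -g(y)` for all `x`, `y` already separates the integrals
    · have hT := h 0 0 fun x y => by simpa using hc0 (x, y)
      obtain ⟨x₀, hx₀⟩ := exists_le_integral (hint Q f)
      have : ∫ y, -f (ι x₀) ∂S ≤ ∫ y, g (ι y) ∂S :=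
        integral_mono (integrable_const _) (hint S g) fun y => by
          have := hv x₀ y
          simp only [zero_mul, add_zero] at this
          change -f (ι x₀) ≤ g (ι y)
          linarith
      simp only [integral_const, probReal_univ, one_smul] at this
      linarith
    -- dividing by `t` gives a pair admissible in the dual problem
    · have key := h (b (t⁻¹ • f)) (b (-(t⁻¹ • g))) fun x y => by
        have := mul_nonneg (inv_nonneg.2 ht.le) (hv x y)
        simp only [hb, ContinuousMap.neg_apply, ContinuousMap.smul_apply, smul_eq_mul]
        have hcan : t⁻¹ * (t * c (x, y)) = c (x, y) := by field_simp
        nlinarith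
      simp only [hb, ContinuousMap.neg_apply, ContinuousMap.smul_apply, smul_eq_mul,
        integral_neg, integral_const_mul] at key
      have := mul_le_mul_of_nonneg_left key ht.le
      have e1 : t * (t⁻¹ * ∫ y, g (ι y) ∂S) = ∫ y, g (ι y) ∂S := by field_simp
      have e2 : t * (t⁻¹ * ∫ x, f (ι x) ∂Q) = ∫ x, f (ι x) ∂Q := by field_simp
      nlinarith
  let D : V →ₗ.[ℝ] ℝ :=
    ⟨LinearMap.ker (LinearMap.fst ℝ C(K × K, ℝ) (C(K, ℝ) × C(K, ℝ) × ℝ)), F.domRestrict _⟩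
  obtain ⟨G, hGF, hGs⟩ := riesz_extension s D (fun v hv => hFs v v.2 hv) (by
    rintro ⟨u, f, g, t⟩
    refine ⟨⟨(0, ContinuousMap.const K ‖u‖ - f, -g, -t), rfl⟩, ?_, fun x y => ?_⟩
    · exact (neg_add_cancel t).ge
    · have := (abs_le.1 (u.norm_coe_le_norm (ι x, ι y))).1
      change 0 ≤ (0 + u (ι x, ι y)) + ((‖u‖ - f (ι x)) + f (ι x)) + (-g (ι y) + g (ι y)) +
        (-t + t) * c (x, y)
      linarith)
  have hG : ∀ f g t, G (0, f, g, t) = ∫ x, f (ι x) ∂Q + ∫ y, g (ι y) ∂S + t * T := fun f g t =>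
    hGF ⟨(0, f, g, t), rfl⟩
  let L : C(K × K, ℝ) →ₗ[ℝ] ℝ := G ∘ₗ LinearMap.inl ℝ C(K × K, ℝ) (C(K, ℝ) × C(K, ℝ) × ℝ)
  have hL : ∀ u f g t, G (u, f, g, t) =
      L u + (∫ x, f (ι x) ∂Q + ∫ y, g (ι y) ∂S + t * T) := fun u f g t => by
    rw [← hG, ← show G (u, 0, 0, 0) = L u from rfl, ← map_add]
    congr 1
    refine Prod.ext (add_zero u).symm (Prod.ext (zero_add f).symm
      (Prod.ext (zero_add g).symm (zero_add t).symm))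
  have key : ∀ (u : C(K × K, ℝ)) (f g : C(K, ℝ)) (t : ℝ), 0 ≤ t →
      (∀ x y, 0 ≤ u (ι x, ι y) + f (ι x) + g (ι y) + t * c (x, y)) →
      0 ≤ L u + (∫ x, f (ι x) ∂Q + ∫ y, g (ι y) ∂S + t * T) := fun u f g t ht hs => by
    rw [← hL]
    exact hGs _ ⟨ht, hs⟩
  -- `(∓f ⊕ 0, ±f, 0, 0)` lies in the cone for both signs, which pins the first marginal of `L`
  refine ⟨L, fun u hu => ?_, fun f => le_antisymm ?_ ?_, fun g => le_antisymm ?_ ?_,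
    fun u hu => ?_⟩
  · simpa using key u 0 0 0 le_rfl fun x y => by simpa using hu (ι x, ι y)
  · have := key (-(f.comp ⟨Prod.fst, continuous_fst⟩)) f 0 0 le_rfl fun x y => by simp
    simp only [map_neg] at this
    simp at this
    linarith
  · have := key (f.comp ⟨Prod.fst, continuous_fst⟩) (-f) 0 0 le_rfl fun x y => by simp
    simp [integral_neg] at this
    linarith
  · have := key (-(g.comp ⟨Prod.snd, continuous_snd⟩)) 0 g 0 le_rfl fun x y => by simp
    simp only [map_neg] at this
    simp at this
    linarith
  · have := key (g.comp ⟨Prod.snd, continuous_snd⟩) 0 (-g) 0 le_rfl fun x y => by simp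
    simp [integral_neg] at this
    linarith
  · have := key (-u) 0 0 1 zero_le_one fun x y => by simpa using hu x y
    simp at this
    linarith

/-- A measure on `K × K` whose marginals are the images of `Q` and `S` under an injection
`ι : E → K` is the image of a coupling of `Q` and `S`. -/
lemma exists_coupling_map_eq [PolishSpace E] {K : Type*} [TopologicalSpace K] [T2Space K]
    [SecondCountableTopology K] [MeasurableSpace K] [BorelSpace K] {ι : E → K}
    (hι : Continuous ι) (hinj : Function.Injective ι) {Q S : Measure E} {μ : Measure (K × K)}
    (hQ : μ.fst = Q.map ι) (hS : μ.snd = S.map ι) :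
    ∃ π ∈ couplings Q S, π.map (Prod.map ι ι) = μ := by
  have hme : MeasurableEmbedding ι := hι.measurableEmbedding hinj
  have hme2 : MeasurableEmbedding (Prod.map ι ι) :=
    (hι.prodMap hι).measurableEmbedding (hinj.prodMap hinj)
  have hrange : MeasurableSet (range ι) := hme.measurableSet_range
  have hnull : μ (range (Prod.map ι ι))ᶜ = 0 := by
    have h1 : μ (Prod.fst ⁻¹' (range ι)ᶜ) = 0 := by
      rw [← Measure.fst_apply hrange.compl, hQ, hme.map_apply]
      simp [preimage_compl]
    have h2 : μ (Prod.snd ⁻¹' (range ι)ᶜ) = 0 := by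
      rw [← Measure.snd_apply hrange.compl, hS, hme.map_apply]
      simp [preimage_compl]
    refine measure_mono_null ?_ (measure_union_null h1 h2)
    rintro ⟨a, b⟩ hab
    by_contra hcon
    simp only [mem_union, mem_preimage, mem_compl_iff, not_or, not_not] at hcon
    obtain ⟨⟨x, hx⟩, ⟨y, hy⟩⟩ := hcon
    exact hab ⟨(x, y), Prod.ext hx hy⟩
  have hmap : (μ.comap (Prod.map ι ι)).map (Prod.map ι ι) = μ := by
    rw [hme2.map_comap]
    exact Measure.restrict_eq_self_of_ae_mem (mem_ae_iff.2 hnull)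
  have hmapinj : ∀ {ν ν' : Measure E}, ν.map ι = ν'.map ι → ν = ν' := fun {ν ν'} h => by
    rw [← hme.comap_map ν, h, hme.comap_map]
  refine ⟨_, ⟨hmapinj ?_, hmapinj ?_⟩, hmap⟩
  · rw [← hQ, ← congrArg Measure.fst hmap, Measure.fst, Measure.fst,
      Measure.map_map hme.measurable measurable_fst, Measure.map_map measurable_fst hme2.measurable]
    rfl
  · rw [← hS, ← congrArg Measure.snd hmap, Measure.snd, Measure.snd,
      Measure.map_map hme.measurable measurable_snd, Measure.map_map measurable_snd hme2.measurable]
    rfl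

/-- Kantorovich duality on a Polish space with a lower semicontinuous cost `c ≥ 0`: if
`S[g] - Q[f] ≤ T` for all bounded continuous `f`, `g` with `g(y) - f(x) ≤ c(x, y)`, then some
coupling of `Q` and `S` has cost at most `T`. -/
theorem exists_coupling_lintegral_le [PolishSpace E] {c : E × E → ℝ} (hc0 : ∀ z, 0 ≤ c z)
    (hc : LowerSemicontinuous c) (Q S : Measure E) [IsProbabilityMeasure Q]
    [IsProbabilityMeasure S] (T : ℝ)
    (h : ∀ f g : E →ᵇ ℝ, (∀ x y, g y ≤ c (x, y) + f x) → ∫ y, g y ∂S ≤ T + ∫ x, f x ∂Q) :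
    ∃ π ∈ couplings Q S, ∫⁻ z, ENNReal.ofReal (c z) ∂π ≤ ENNReal.ofReal T := by
  obtain ⟨ι, hι⟩ : ∃ F : E → ℕ → unitInterval, IsEmbedding F := by
    let := TopologicalSpace.upgradeIsCompletelyMetrizable E
    exact Metric.PiNatEmbed.exists_embedding_to_hilbert_cube
  let K := ℕ → unitInterval
  let : MetricSpace K := TopologicalSpace.metrizableSpaceMetric K
  have hιm : Measurable ι := hι.continuous.measurable
  have hιc2 : Continuous (Prod.map ι ι) := hι.continuous.prodMap hι.continuous
  obtain ⟨L, hL0, hLQ, hLR, hLT⟩ := exists_functional (K := K) hι.continuous hc0 Q S T h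
  obtain ⟨μ, hμ, hμL⟩ := exists_measure_integral_eq L hL0
  have hprobQ : IsProbabilityMeasure (Q.map ι) := Measure.isProbabilityMeasure_map hιm.aemeasurable
  have hprobS : IsProbabilityMeasure (S.map ι) := Measure.isProbabilityMeasure_map hιm.aemeasurable
  have hQ : μ.fst = Q.map ι := by
    refine ext_of_forall_integral_eq_of_IsFiniteMeasure fun f => ?_
    rw [Measure.fst, integral_map measurable_fst.aemeasurable
        f.continuous.measurable.aestronglyMeasurable,
      integral_map hιm.aemeasurable f.continuous.measurable.aestronglyMeasurable]
    exact (hμL _).trans (hLQ f.toContinuousMap)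
  have hS : μ.snd = S.map ι := by
    refine ext_of_forall_integral_eq_of_IsFiniteMeasure fun f => ?_
    rw [Measure.snd, integral_map measurable_snd.aemeasurable
        f.continuous.measurable.aestronglyMeasurable,
      integral_map hιm.aemeasurable f.continuous.measurable.aestronglyMeasurable]
    exact (hμL _).trans (hLR f.toContinuousMap)
  obtain ⟨π, hπ, hπμ⟩ := exists_coupling_map_eq hι.continuous hι.injective hQ hS
  refine ⟨π, hπ, ?_⟩
  obtain ⟨u, hu, hulim⟩ := exists_seq_continuousMap_tendsto (hι.prodMap hι).isInducing hc0 hc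
  have hT : 0 ≤ T := by simpa using h 0 0 fun x y => by simpa using hc0 (x, y)
  have hfin : IsFiniteMeasure π := ⟨by
    have h1 : π univ = μ univ := by
      rw [← hπμ, Measure.map_apply hιc2.measurable MeasurableSet.univ, preimage_univ]
    rw [h1]
    exact measure_lt_top _ _⟩
  have hcont : ∀ n, Continuous fun z => u n (Prod.map ι ι z) := fun n =>
    (u n).continuous.comp hιc2
  have hbound : ∀ n, ∫⁻ z, ENNReal.ofReal (u n (Prod.map ι ι z)) ∂π ≤ ENNReal.ofReal T := by
    intro n
    let v : C(K × K, ℝ) := u n ⊔ 0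
    have hv : ∀ z, ENNReal.ofReal (u n (Prod.map ι ι z)) = ENNReal.ofReal (v (Prod.map ι ι z)) :=
      fun z => by simp [v, ENNReal.ofReal_max]
    have hvint : Integrable (fun z => v (Prod.map ι ι z)) π :=
      ((BoundedContinuousFunction.mkOfCompact v).compContinuous ⟨_, hιc2⟩).integrable π
    simp only [hv]
    rw [← ofReal_integral_eq_lintegral_ofReal hvint (ae_of_all _ fun z => le_max_right _ _)]
    refine ENNReal.ofReal_le_ofReal ?_
    rw [← integral_map hιc2.measurable.aemeasurable (f := v)
      v.continuous.measurable.aestronglyMeasurable, hπμ, hμL]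
    exact hLT v fun x y => max_le (hu n (x, y)) (hc0 _)
  calc ∫⁻ z, ENNReal.ofReal (c z) ∂π
      = ∫⁻ z, liminf (fun n => ENNReal.ofReal (u n (Prod.map ι ι z))) atTop ∂π :=
        lintegral_congr fun z =>
          ((ENNReal.continuous_ofReal.tendsto _).comp (hulim z)).liminf_eq.symm
    _ ≤ liminf (fun n => ∫⁻ z, ENNReal.ofReal (u n (Prod.map ι ι z)) ∂π) atTop :=
        lintegral_liminf_le fun n => (hcont n).measurable.ennreal_ofReal
    _ ≤ ENNReal.ofReal T := liminf_le_of_le (by isBoundedDefault) fun b hb => by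
        obtain ⟨n, hn⟩ := hb.exists
        exact hn.trans (hbound n)

end Kantorovich

/-! ### Gibbs' variational principle -/

section Gibbs

variable {Ω : Type*} [MeasurableSpace Ω] {P : Measure Ω} [IsProbabilityMeasure P]

lemma EReal_exp_eq_ofReal {a : EReal} (h1 : a ≠ ⊤) (h2 : a ≠ ⊥) :
    EReal.exp a = ENNReal.ofReal (Real.exp a.toReal) := by
  conv_lhs => rw [← EReal.coe_toReal h1 h2]
  rfl

/-- Gibbs' variational inequality: `log P[exp φ] ≤ 0` implies `Q[φ] ≤ K(Q | P)`. It follows from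
`t ≤ exp t - 1` at `t = φ - log (dQ/dP)`. -/
lemma integral_toReal_le_toReal_klDiv {φ : Ω → EReal} (hφ : AEMeasurable φ P)
    (hP : ∫⁻ x, EReal.exp (φ x) ∂P ≤ 1) (Q : Measure Ω) [IsProbabilityMeasure Q]
    (hK : klDiv Q P ≠ ∞) (hbot : ∀ᵐ x ∂Q, φ x ≠ ⊥) (hint : Integrable (fun x => (φ x).toReal) Q) :
    ∫ x, (φ x).toReal ∂Q ≤ (klDiv Q P).toReal := by
  obtain ⟨hac, hllr⟩ := klDiv_ne_top_iff.1 hK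
  rw [toReal_klDiv_of_measure_eq hac (by simp)]
  have hexp : AEMeasurable (fun x => EReal.exp (φ x)) P :=
    EReal.measurable_exp.comp_aemeasurable hφ
  have htop : ∀ᵐ x ∂Q, φ x ≠ ⊤ := by
    refine hac.ae_le ?_
    filter_upwards [ae_lt_top' hexp (hP.trans_lt ENNReal.one_lt_top).ne] with x hx
    exact (EReal.exp_lt_top_iff.1 hx).ne
  let ψ : Ω → ℝ := fun x => (φ x).toReal - llr Q P x
  have hψ : Integrable ψ Q := hint.sub hllr
  have hlint : ∫⁻ x, ENNReal.ofReal (Real.exp (ψ x)) ∂Q ≤ 1 := by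
    calc ∫⁻ x, ENNReal.ofReal (Real.exp (ψ x)) ∂Q
        = ∫⁻ x, P.rnDeriv Q x * EReal.exp (φ x) ∂Q := by
          refine lintegral_congr_ae ?_
          filter_upwards [hbot, htop, exp_neg_llr hac, P.rnDeriv_lt_top Q] with x h1 h2 h3 h4
          have hx : ψ x = -llr Q P x + (φ x).toReal := by simp only [ψ]; ring
          rw [EReal_exp_eq_ofReal h2 h1, hx,
            Real.exp_add, h3, ENNReal.ofReal_mul ENNReal.toReal_nonneg,
            ENNReal.ofReal_toReal h4.ne]
      _ = ∫⁻ x, EReal.exp (φ x) ∂(Q.withDensity (P.rnDeriv Q)) := by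
          rw [lintegral_withDensity_eq_lintegral_mul₀ (P.measurable_rnDeriv Q).aemeasurable
            (hexp.mono_ac hac)]
          rfl
      _ ≤ ∫⁻ x, EReal.exp (φ x) ∂P := lintegral_mono' (P.withDensity_rnDeriv_le Q) le_rfl
      _ ≤ 1 := hP
  have hexpint : Integrable (fun x => Real.exp (ψ x)) Q := by
    refine ⟨Real.continuous_exp.comp_aestronglyMeasurable hψ.1, ?_⟩
    rw [hasFiniteIntegral_iff_ofReal (ae_of_all _ fun x => (Real.exp_pos _).le)]
    exact hlint.trans_lt ENNReal.one_lt_top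
  have h1 : ∫ x, Real.exp (ψ x) ∂Q ≤ 1 := by
    rw [integral_eq_lintegral_of_nonneg_ae (ae_of_all _ fun x => (Real.exp_pos _).le) hexpint.1]
    exact ENNReal.toReal_le_of_le_ofReal zero_le_one (by simpa using hlint)
  have h2 : ∫ x, ψ x ∂Q ≤ ∫ x, (Real.exp (ψ x) - 1) ∂Q :=
    integral_mono hψ (hexpint.sub (integrable_const _)) fun x => by
      have := Real.add_one_le_exp (ψ x)
      change ψ x ≤ Real.exp (ψ x) - 1
      linarith
  rw [integral_sub hexpint (integrable_const _), integral_const, probReal_univ, one_smul] at h2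
  have h3 : ∫ x, ψ x ∂Q = ∫ x, (φ x).toReal ∂Q - ∫ x, llr Q P x ∂Q := integral_sub hint hllr
  linarith

lemma abs_mul_exp_le {t M : ℝ} (h : t ≤ M) : |t| * Real.exp t ≤ 1 + |M| * Real.exp M := by
  have hM : 0 ≤ |M| * Real.exp M := by positivity
  rcases le_total t 0 with ht | ht
  · have h1 : -t ≤ Real.exp (-t) := by linarith [Real.add_one_le_exp (-t)]
    have h2 := mul_le_mul_of_nonneg_right h1 (Real.exp_pos t).le
    rw [← Real.exp_add, neg_add_cancel, Real.exp_zero] at h2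
    rw [abs_of_nonpos ht]
    linarith
  · have : |t| * Real.exp t ≤ |M| * Real.exp M :=
      mul_le_mul (abs_le_abs_of_nonneg ht h) (Real.exp_le_exp.2 h) (Real.exp_pos _).le
        (abs_nonneg _)
    linarith

/-- Gibbs' variational principle, in the direction in which the supremum is attained: the measure
with density proportional to `exp φ` turns `Q[φ] ≤ K(Q | P)` into `log P[exp φ] ≤ 0`. -/
lemma lintegral_exp_le_one {φ : Ω → EReal} (hφ : AEMeasurable φ P) {M : ℝ}
    (hM : ∀ x, φ x ≤ M)
    (h : ∀ Q : Measure Ω, IsProbabilityMeasure Q → klDiv Q P ≠ ∞ → (∀ᵐ x ∂Q, φ x ≠ ⊥) →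
      Integrable (fun x => (φ x).toReal) Q → ∫ x, (φ x).toReal ∂Q ≤ (klDiv Q P).toReal) :
    ∫⁻ x, EReal.exp (φ x) ∂P ≤ 1 := by
  have hexp : AEMeasurable (fun x => EReal.exp (φ x)) P :=
    EReal.measurable_exp.comp_aemeasurable hφ
  set Z := ∫⁻ x, EReal.exp (φ x) ∂P with hZ
  rcases eq_or_ne Z 0 with hZ0 | hZ0
  · simp [hZ0]
  have hZt : Z ≠ ∞ := by
    have : Z ≤ ∫⁻ _, ENNReal.ofReal (Real.exp M) ∂P :=
      lintegral_mono fun x => EReal.exp_monotone (hM x)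
    refine (this.trans_lt ?_).ne
    simp
  have htop : ∀ x, φ x ≠ ⊤ := fun x => ((hM x).trans_lt (EReal.coe_lt_top M)).ne
  let w : Ω → ℝ≥0∞ := fun x => Z⁻¹ * EReal.exp (φ x)
  have hw : AEMeasurable w P := hexp.const_mul _
  let Q := P.withDensity w
  have hQ : IsProbabilityMeasure Q := ⟨by
    rw [withDensity_apply _ MeasurableSet.univ, Measure.restrict_univ,
      lintegral_const_mul'' _ hexp, ← hZ, ENNReal.inv_mul_cancel hZ0 hZt]⟩
  have hac : Q ≪ P := withDensity_absolutelyContinuous _ _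
  have hbot : ∀ᵐ x ∂Q, φ x ≠ ⊥ := by
    rw [ae_withDensity_iff' hw]
    refine ae_of_all _ fun x hx hcon => hx ?_
    simp [w, hcon]
  have hllr : llr Q P =ᵐ[Q] fun x => (φ x).toReal - Real.log Z.toReal := by
    filter_upwards [hac.ae_le (Measure.rnDeriv_withDensity₀ P hw), hbot] with x h1 h2
    rw [llr, h1]
    simp only [w]
    rw [EReal_exp_eq_ofReal (htop x) h2, ENNReal.toReal_mul, ENNReal.toReal_inv,
      ENNReal.toReal_ofReal (Real.exp_pos _).le,
      Real.log_mul (inv_ne_zero (ENNReal.toReal_ne_zero.2 ⟨hZ0, hZt⟩)) (Real.exp_ne_zero _),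
      Real.log_exp, Real.log_inv]
    ring
  have hreal : AEMeasurable (fun x => (φ x).toReal) P := hφ.ereal_toReal
  have hint : Integrable (fun x => (φ x).toReal) Q := by
    refine ⟨(hreal.mono_ac hac).aestronglyMeasurable, ?_⟩
    rw [HasFiniteIntegral, lintegral_withDensity_eq_lintegral_mul₀ hw hreal.enorm]
    have hbd : ∀ x, (w * fun x => ‖(φ x).toReal‖ₑ) x ≤
        Z⁻¹ * ENNReal.ofReal (1 + |M| * Real.exp M) := fun x => by
      simp only [Pi.mul_apply, w, mul_assoc]
      gcongr
      rcases eq_or_ne (φ x) ⊥ with hx | hx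
      · simp [hx]
      rw [EReal_exp_eq_ofReal (htop x) hx, Real.enorm_eq_ofReal_abs,
        ← ENNReal.ofReal_mul (Real.exp_pos _).le, mul_comm]
      refine ENNReal.ofReal_le_ofReal (abs_mul_exp_le ?_)
      have := hM x
      rw [← EReal.coe_toReal (htop x) hx] at this
      exact EReal.coe_le_coe_iff.1 this
    refine (lintegral_mono hbd).trans_lt ?_
    rw [lintegral_const, measure_univ, mul_one]
    exact ENNReal.mul_lt_top (ENNReal.inv_lt_top.2 (pos_iff_ne_zero.2 hZ0)) ENNReal.ofReal_lt_top
  have hllrint : Integrable (llr Q P) Q :=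
    (integrable_congr hllr).2 (hint.sub (integrable_const _))
  have key := h Q hQ (klDiv_ne_top hac hllrint) hbot hint
  rw [toReal_klDiv_of_measure_eq hac (by simp), integral_congr_ae hllr,
    integral_sub hint (integrable_const _), integral_const, probReal_univ, one_smul] at key
  have hlog : Real.log Z.toReal ≤ 0 := by linarith
  have hpos : 0 < Z.toReal := ENNReal.toReal_pos hZ0 hZt
  rw [← ENNReal.ofReal_toReal hZt, ← ENNReal.ofReal_one]
  refine ENNReal.ofReal_le_ofReal ?_
  have := (Real.log_nonpos_iff hpos.le).1 hlog
  exact this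

end Gibbs

/-! ### The weak transport cost in dual form -/

section Moments

variable {Ω : Type*} [MeasurableSpace Ω]

lemma measurable_powDiv (q : ℝ≥0∞) : Measurable (powDiv q) := by
  unfold powDiv
  split_ifs with h
  · exact Measurable.ite measurableSet_Iic measurable_const measurable_const
  · fun_prop

lemma lintegral_powDiv_of_ne_top {q : ℝ≥0∞} (hq : q ≠ 0) (hq' : q ≠ ∞) (S : Measure Ω)
    (α : Ω → ℝ≥0) :
    ∫⁻ y, powDiv q (α y) ∂S = eLpNorm (fun y => (α y : ℝ)) q S ^ q.toReal / q := by
  have hr : q.toReal ≠ 0 := ENNReal.toReal_ne_zero.2 ⟨hq, hq'⟩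
  rw [eLpNorm_eq_lintegral_rpow_enorm_toReal hq hq', ← ENNReal.rpow_mul, one_div,
    inv_mul_cancel₀ hr, ENNReal.rpow_one]
  simp only [powDiv, hq', if_false, div_eq_mul_inv, NNReal.enorm_eq]
  rw [lintegral_mul_const' _ _ (ENNReal.inv_ne_top.2 hq)]

lemma eLpNorm_top_le_one_iff (S : Measure Ω) (α : Ω → ℝ≥0) :
    eLpNorm (fun y => (α y : ℝ)) ∞ S ≤ 1 ↔ ∀ᵐ y ∂S, (α y : ℝ≥0∞) ≤ 1 := by
  have he : ∀ y, ‖(α y : ℝ)‖ₑ = α y := fun y => by simp [enorm_eq_nnnorm]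
  rw [eLpNorm_exponent_top, eLpNormEssSup]
  simp only [he]
  refine ⟨fun h => ?_, fun h => essSup_le_of_ae_le _ h⟩
  filter_upwards [ENNReal.ae_le_essSup (μ := S) fun y => (α y : ℝ≥0∞)] with y hy
  exact hy.trans h

/-- The concavity inequality `x ^ (2 / q) ≤ 1 + (2 / q) (x - 1)` for `q ≥ 2`, integrated. -/
lemma eLpNorm_sq_div_two_add_inv_le {q : ℝ≥0∞} (hq : 2 ≤ q) (S : Measure Ω)
    {α : Ω → ℝ≥0} (hα : Measurable α) :
    eLpNorm (fun y => (α y : ℝ)) q S ^ 2 / 2 + q⁻¹ ≤ ∫⁻ y, powDiv q (α y) ∂S + 1 / 2 := by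
  rcases eq_or_ne (∫⁻ y, powDiv q (α y) ∂S) ∞ with hA | hA
  · simp [hA]
  rcases eq_or_ne q ∞ with rfl | hq'
  · have hN : eLpNorm (fun y => (α y : ℝ)) ∞ S ≤ 1 := by
      rw [eLpNorm_top_le_one_iff]
      have hm : Measurable fun y => powDiv ∞ (α y) :=
        (measurable_powDiv ∞).comp hα.coe_nnreal_ennreal
      filter_upwards [ae_lt_top hm hA] with y hy
      by_contra hcon
      simp [powDiv, hcon] at hy
    have : eLpNorm (fun y => (α y : ℝ)) ∞ S ^ 2 ≤ 1 := pow_le_one₀ zero_le hN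
    rw [ENNReal.inv_top, add_zero]
    exact (ENNReal.div_le_div_right this 2).trans le_add_self
  · have hq0 : q ≠ 0 := (two_pos.trans_le hq).ne'
    have hr2 : 2 ≤ q.toReal := by simpa using ENNReal.toReal_mono hq' hq
    rw [lintegral_powDiv_of_ne_top hq0 hq'] at hA ⊢
    set N := eLpNorm (fun y => (α y : ℝ)) q S
    have hN : N ≠ ∞ := fun h => hA (by
      rw [h, ENNReal.top_rpow_of_pos (by linarith), ENNReal.top_div_of_ne_top hq'])
    clear_value N
    lift N to ℝ≥0 using hN
    lift q to ℝ≥0 using hq'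
    simp only [ENNReal.coe_toReal] at *
    have hq0' : q ≠ 0 := by simpa using hq0
    have hq0r : (q : ℝ) ≠ 0 := by simpa using hq0'
    rw [← ENNReal.coe_rpow_of_nonneg _ q.coe_nonneg, ← ENNReal.coe_inv hq0',
      ← ENNReal.coe_div hq0', ← ENNReal.coe_pow, ← ENNReal.coe_ofNat, ← ENNReal.coe_one,
      ← ENNReal.coe_div two_ne_zero, ← ENNReal.coe_div two_ne_zero, ← ENNReal.coe_add,
      ← ENNReal.coe_add, ENNReal.coe_le_coe, ← NNReal.coe_le_coe]
    push_cast
    have key := Real.geom_mean_le_arith_mean2_weighted (w₁ := 2 / (q : ℝ)) (w₂ := 1 - 2 / (q : ℝ))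
      (p₁ := (N : ℝ) ^ (q : ℝ)) (p₂ := 1) (by positivity)
      (sub_nonneg.2 ((div_le_one (by linarith)).2 hr2)) (by positivity) zero_le_one (by ring)
    rw [← Real.rpow_mul N.coe_nonneg, mul_div_cancel₀ _ hq0r, Real.one_rpow, mul_one,
      Real.rpow_two] at key
    have e1 : 2 / (q : ℝ) * (N : ℝ) ^ (q : ℝ) = 2 * ((N : ℝ) ^ (q : ℝ) / q) := by ring
    have e2 : 2 / (q : ℝ) = 2 * (q : ℝ)⁻¹ := by ring
    rw [e1] at key
    linarith

lemma lintegral_powDiv_le_inv {q : ℝ≥0∞} (hq : 2 ≤ q) (S : Measure Ω) {α : Ω → ℝ≥0}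
    (h : eLpNorm (fun y => (α y : ℝ)) q S ≤ 1) : ∫⁻ y, powDiv q (α y) ∂S ≤ q⁻¹ := by
  rcases eq_or_ne q ∞ with rfl | hq'
  · rw [eLpNorm_top_le_one_iff] at h
    rw [ENNReal.inv_top, nonpos_iff_eq_zero, lintegral_congr_ae (g := fun _ => 0), lintegral_zero]
    filter_upwards [h] with y hy
    simp only [powDiv, if_true, hy]
  · rw [lintegral_powDiv_of_ne_top (two_pos.trans_le hq).ne' hq', ← one_div]
    exact ENNReal.div_le_div_right (ENNReal.rpow_le_one h ENNReal.toReal_nonneg) q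

end Moments

section Duality

variable {E : Type*} {d : E → E → ℝ} {α : E → ℝ≥0}

lemma neg_norm_le_infConv [TopologicalSpace E] (hd : ∀ x y, 0 ≤ d x y) (f : E →ᵇ ℝ) (y : E) :
    -‖f‖ ≤ infConv α d f y := by
  have : Nonempty E := ⟨y⟩
  refine le_ciInf fun x => ?_
  have := mul_nonneg (α y).coe_nonneg (hd x y)
  linarith [(abs_le.1 (f.norm_coe_le_norm x)).1]

lemma infConv_le_add [TopologicalSpace E] (hd : ∀ x y, 0 ≤ d x y) (f : E →ᵇ ℝ) (x y : E) :
    infConv α d f y ≤ α y * d x y + f x :=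
  ciInf_le (bddBelow_infConv hd (fun x => (abs_le.1 (f.norm_coe_le_norm x)).1) y) x

lemma infConv_le [TopologicalSpace E] (hd : IsMetric d) (f : E →ᵇ ℝ) (y : E) :
    infConv α d f y ≤ f y := by
  simpa [(hd.eq_zero_iff y y).2 rfl] using infConv_le_add (α := α) hd.nonneg f y y

lemma lowerSemicontinuous_mul {X : Type*} [TopologicalSpace X] {f g : X → ℝ}
    (hf : LowerSemicontinuous f) (hg : LowerSemicontinuous g) (hf0 : ∀ x, 0 ≤ f x)
    (hg0 : ∀ x, 0 ≤ g x) : LowerSemicontinuous fun x => f x * g x := by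
  intro x a ha
  rcases lt_or_ge a 0 with ha0 | ha0
  · exact Eventually.of_forall fun z => ha0.trans_le (mul_nonneg (hf0 z) (hg0 z))
  have hpos : 0 < f x * g x := ha0.trans_lt ha
  have hfx : 0 < f x := (hf0 x).lt_of_ne fun h => by simp [← h] at hpos
  obtain ⟨v, hav, hv⟩ := exists_between ((div_lt_iff₀' hfx).2 ha)
  have hv0 : 0 < v := (div_nonneg ha0 hfx.le).trans_lt hav
  have hau : a / v < f x := (div_lt_iff₀ hv0).2 ((div_lt_iff₀' hfx).1 hav)
  filter_upwards [hf x _ hau, hg x _ hv] with z hz1 hz2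
  calc a = a / v * v := (div_mul_cancel₀ _ hv0.ne').symm
    _ < f z * v := mul_lt_mul_of_pos_right hz1 hv0
    _ ≤ f z * g z := mul_le_mul_of_nonneg_left hz2.le (hf0 z)

lemma lintegral_cost_eq [MeasurableSpace E] (π : Measure (E × E)) :
    ∫⁻ z, (α z.2 : ℝ≥0∞) * ENNReal.ofReal (d z.1 z.2) ∂π =
      ∫⁻ z, ENNReal.ofReal (α z.2 * d z.1 z.2) ∂π := by
  refine lintegral_congr fun z => ?_
  rw [ENNReal.ofReal_mul (α z.2).coe_nonneg, ENNReal.ofReal_coe_nnreal]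

lemma prod_mem_couplings [MeasurableSpace E] (Q S : Measure E) [IsProbabilityMeasure Q]
    [IsProbabilityMeasure S] : Q.prod S ∈ couplings Q S := by simp [couplings]

lemma lintegral_prod_cost_eq_zero [MeasurableSpace E] (Q S : Measure E) [IsProbabilityMeasure Q]
    [IsProbabilityMeasure S] {q : ℝ≥0∞} (hq : q ≠ 0) (hα : Measurable α)
    (h : eLpNorm (fun y => (α y : ℝ)) q S = 0) :
    ∫⁻ z, (α z.2 : ℝ≥0∞) * ENNReal.ofReal (d z.1 z.2) ∂(Q.prod S) = 0 := by
  rw [eLpNorm_eq_zero_iff hα.coe_nnreal_real.aestronglyMeasurable hq] at h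
  have h' : ∀ᵐ z ∂(Q.prod S), (α z.2 : ℝ) = 0 := Measure.quasiMeasurePreserving_snd.ae h
  rw [lintegral_congr_ae (g := fun _ => 0), lintegral_zero]
  filter_upwards [h'] with z hz
  simp [NNReal.coe_eq_zero.1 hz]

variable [TopologicalSpace E] [PolishSpace E] [MeasurableSpace E] [BorelSpace E]

lemma integrable_infConv (hd : IsMetric d) (hdm : Measurable fun z : E × E => d z.1 z.2)
    (hα : Measurable α) (f : E →ᵇ ℝ) (μ : Measure E) [IsFiniteMeasure μ] :
    Integrable (infConv α d f) μ := by
  refine Integrable.of_bound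
    (aemeasurable_infConv hd.nonneg hdm hα f μ).aestronglyMeasurable ‖f‖ (ae_of_all _ fun y => ?_)
  exact abs_le.2 ⟨neg_norm_le_infConv hd.nonneg f y,
    (infConv_le hd f y).trans (abs_le.1 (f.norm_coe_le_norm y)).2⟩

/-- The easy half of Kantorovich duality. -/
lemma ofReal_infConv_sub_le_lintegral (hd : IsMetric d)
    (hdm : Measurable fun z : E × E => d z.1 z.2) (hα : Measurable α) (f : E →ᵇ ℝ)
    {Q S : Measure E} [IsProbabilityMeasure Q] [IsProbabilityMeasure S] {π : Measure (E × E)}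
    (hπ : π ∈ couplings Q S) :
    ENNReal.ofReal (∫ y, infConv α d f y ∂S - ∫ x, f x ∂Q) ≤
      ∫⁻ z, (α z.2 : ℝ≥0∞) * ENNReal.ofReal (d z.1 z.2) ∂π := by
  rw [lintegral_cost_eq]
  rcases eq_or_ne (∫⁻ z, ENNReal.ofReal (α z.2 * d z.1 z.2) ∂π) ∞ with htop | htop
  · rw [htop]; exact le_top
  obtain ⟨rfl, rfl⟩ := hπ
  have hm : Measurable fun z : E × E => (α z.2 : ℝ) * d z.1 z.2 :=
    (hα.comp measurable_snd).coe_nnreal_real.mul hdm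
  have h0 : ∀ z : E × E, 0 ≤ (α z.2 : ℝ) * d z.1 z.2 := fun z =>
    mul_nonneg (α z.2).coe_nonneg (hd.nonneg _ _)
  have hc : Integrable (fun z : E × E => (α z.2 : ℝ) * d z.1 z.2) π := by
    refine ⟨hm.aestronglyMeasurable, ?_⟩
    rw [hasFiniteIntegral_iff_ofReal (ae_of_all _ h0)]
    exact htop.lt_top
  have hS : ∫ y, infConv α d f y ∂π.snd = ∫ z, infConv α d f z.2 ∂π :=
    integral_map measurable_snd.aemeasurable (integrable_infConv hd hdm hα f π.snd).1
  have hQ : ∫ x, f x ∂π.fst = ∫ z, f z.1 ∂π :=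
    integral_map measurable_fst.aemeasurable (f.integrable π.fst).1
  have hSi : Integrable (fun z : E × E => infConv α d f z.2) π :=
    (integrable_infConv hd hdm hα f π.snd).comp_measurable measurable_snd
  have hQi : Integrable (fun z : E × E => f z.1) π :=
    (f.integrable π.fst).comp_measurable measurable_fst
  rw [← ofReal_integral_eq_lintegral_ofReal hc (ae_of_all _ h0), hS, hQ, ← integral_sub hSi hQi]
  refine ENNReal.ofReal_le_ofReal (integral_mono (hSi.sub hQi) hc fun z => ?_)
  have := infConv_le_add (α := α) hd.nonneg f z.1 z.2
  change infConv α d f z.2 - f z.1 ≤ α z.2 * d z.1 z.2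
  linarith

/-- Kantorovich duality for the cost `α(y) d(x, y)`. -/
lemma exists_coupling_lintegral_cost_le (hd : IsMetric d)
    (hdlsc : LowerSemicontinuous fun z : E × E => d z.1 z.2) (hα : LowerSemicontinuous α)
    (Q S : Measure E) [IsProbabilityMeasure Q] [IsProbabilityMeasure S] {T : ℝ}
    (h : ∀ f : E →ᵇ ℝ, ∫ y, infConv α d f y ∂S - ∫ x, f x ∂Q ≤ T) :
    ∃ π ∈ couplings Q S,
      ∫⁻ z, (α z.2 : ℝ≥0∞) * ENNReal.ofReal (d z.1 z.2) ∂π ≤ ENNReal.ofReal T := by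
  simp only [lintegral_cost_eq]
  have hα' : LowerSemicontinuous fun z : E × E => (α z.2 : ℝ) := fun z a ha =>
    (continuous_snd.tendsto z).eventually
      (NNReal.continuous_coe.comp_lowerSemicontinuous hα NNReal.coe_mono z.2 a ha)
  refine exists_coupling_lintegral_le (c := fun z => (α z.2 : ℝ) * d z.1 z.2)
    (fun z => mul_nonneg (α z.2).coe_nonneg (hd.nonneg _ _))
    (lowerSemicontinuous_mul hα' hdlsc (fun z => (α z.2).coe_nonneg)
      fun z => hd.nonneg _ _) Q S T fun f g hgf => ?_
  have hle : ∫ y, g y ∂S ≤ ∫ y, infConv α d f y ∂S :=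
    integral_mono (g.integrable S) (integrable_infConv hd hdlsc.measurable hα.measurable f S)
      fun y => have : Nonempty E := ⟨y⟩; le_ciInf fun x => hgf x y
  linarith [h f]

/-- The bound `weakCost q d Q S ≤ √(2 C k)` in dual form: Kantorovich duality turns the transport
cost into a supremum over `f`, and the product of `S[α ^ q] ^ (1 / q)` and `√(2 C k)` is linearized
by the parameter `l`. -/
theorem weakCost_le_iff (hd : IsMetric d)
    (hdlsc : LowerSemicontinuous fun z : E × E => d z.1 z.2) {q : ℝ≥0∞} (hq : 2 ≤ q)
    {C : ℝ} (hC : 0 < C) (Q S : Measure E) [IsProbabilityMeasure Q] [IsProbabilityMeasure S]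
    {k : ℝ} (hk : 0 ≤ k) :
    weakCost q d Q S ≤ (2 * ENNReal.ofReal C * ENNReal.ofReal k) ^ (1 / 2 : ℝ) ↔
      ∀ l : ℝ, 0 < l → ∀ α : E → ℝ≥0, LowerSemicontinuous α → ∀ f : E →ᵇ ℝ,
        ∫⁻ y, powDiv q (α y) ∂S ≠ ∞ →
        l * (∫ y, infConv α d f y ∂S - ∫ x, f x ∂Q) -
          C * l ^ 2 * ((∫⁻ y, powDiv q (α y) ∂S).toReal - (q⁻¹).toReal + 1 / 2) ≤ k := by
  have hq0 : q ≠ 0 := (two_pos.trans_le hq).ne'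
  have hB : (2 * ENNReal.ofReal C * ENNReal.ofReal k) ^ (1 / 2 : ℝ) =
      ENNReal.ofReal √(2 * C * k) := by
    rw [← ENNReal.ofReal_ofNat, ← ENNReal.ofReal_mul zero_le_two,
      ← ENNReal.ofReal_mul (by positivity), ENNReal.ofReal_rpow_of_nonneg (by positivity)
      (by norm_num), Real.sqrt_eq_rpow]
  rw [hB]
  have hs0 := Real.sqrt_nonneg (2 * C * k)
  have hs2 := Real.sq_sqrt (show 0 ≤ 2 * C * k by positivity)
  set s := √(2 * C * k)
  have hdm := hdlsc.measurable
  constructor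
  · intro h l hl α hα f hA
    have hαm := hα.measurable
    set D := ∫ y, infConv α d f y ∂S - ∫ x, f x ∂Q
    have hJ := eLpNorm_sq_div_two_add_inv_le hq S hαm
    set A := ∫⁻ y, powDiv q (α y) ∂S
    set N := eLpNorm (fun y => (α y : ℝ)) q S
    have hNt : N ≠ ∞ := fun hNt => by
      rw [hNt, ENNReal.top_pow two_ne_zero, ENNReal.top_div_of_ne_top ENNReal.ofNat_ne_top,
        top_add] at hJ
      exact (ENNReal.add_lt_top.2 ⟨hA.lt_top, by simp⟩).not_ge hJ
    have hDN : ENNReal.ofReal D ≤ ENNReal.ofReal s * N := by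
      rcases eq_or_ne N 0 with hN0 | hN0
      · rw [hN0, mul_zero, ← lintegral_prod_cost_eq_zero (d := d) Q S hq0 hαm hN0]
        exact ofReal_infConv_sub_le_lintegral hd hdm hαm f (prod_mem_couplings Q S)
      · rw [← ENNReal.div_le_iff hN0 hNt]
        refine le_trans (le_trans ?_ (le_iSup₂ (α := ℝ≥0∞) α hα)) h
        exact le_iInf₂ fun π hπ =>
          ENNReal.div_le_div_right (ofReal_infConv_sub_le_lintegral hd hdm hαm f hπ) _
    have hDN' : D ≤ s * N.toReal := by
      rw [← ENNReal.ofReal_toReal hNt, ← ENNReal.ofReal_mul hs0] at hDN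
      exact (ENNReal.ofReal_le_ofReal_iff (by positivity)).1 hDN
    have hJ' : N.toReal ^ 2 / 2 + (q⁻¹).toReal ≤ A.toReal + 1 / 2 := by
      have hqi : q⁻¹ ≠ ∞ := ENNReal.inv_ne_top.2 hq0
      have := ENNReal.toReal_mono (by simp [hA]) hJ
      rw [ENNReal.toReal_add (by simp [ENNReal.div_eq_top, hNt]) hqi,
        ENNReal.toReal_add hA (by simp)] at this
      simpa using this
    have h1 : l * D ≤ l * (s * N.toReal) := mul_le_mul_of_nonneg_left hDN' hl.le
    have h2 : C * l ^ 2 * (N.toReal ^ 2 / 2) ≤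
        C * l ^ 2 * (A.toReal - (q⁻¹).toReal + 1 / 2) :=
      mul_le_mul_of_nonneg_left (by linarith) (by positivity)
    have h3 : l * (s * N.toReal) ≤ k + C * l ^ 2 * (N.toReal ^ 2 / 2) := by
      refine le_of_mul_le_mul_left ?_ (show 0 < 2 * C by positivity)
      nlinarith [sq_nonneg (s - C * l * N.toReal)]
    linarith
  · intro h
    refine iSup₂_le fun α hα => ?_
    set N := eLpNorm (fun y => (α y : ℝ)) q S with hN
    rcases eq_or_ne N 0 with hN0 | hN0
    · refine (iInf₂_le _ (prod_mem_couplings Q S)).trans ?_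
      rw [lintegral_prod_cost_eq_zero Q S hq0 hα.measurable hN0]
      simp
    rcases eq_or_ne N ∞ with hNt | hNt
    · refine (iInf₂_le _ (prod_mem_couplings Q S)).trans ?_
      simp [hNt]
    -- rescaling `α` to have norm one
    let a : ℝ≥0 := N.toNNReal⁻¹
    have haN : (a : ℝ≥0∞) = N⁻¹ := by
      rw [ENNReal.coe_inv (ENNReal.toNNReal_ne_zero.2 ⟨hN0, hNt⟩), ENNReal.coe_toNNReal hNt]
    have hβ : LowerSemicontinuous fun y => a * α y :=
      (continuous_const_mul a).comp_lowerSemicontinuous hα fun _ _ h => mul_le_mul_right h a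
    have hnorm : eLpNorm (fun y => ((a * α y : ℝ≥0) : ℝ)) q S = 1 := by
      have : (fun y => ((a * α y : ℝ≥0) : ℝ)) = (a : ℝ) • fun y => (α y : ℝ) := by
        ext; simp
      rw [this, eLpNorm_const_smul, ← hN]
      simp only [enorm_eq_nnnorm, NNReal.nnnorm_eq, haN]
      exact ENNReal.inv_mul_cancel hN0 hNt
    have hA := lintegral_powDiv_le_inv hq S hnorm.le
    have hqi : q⁻¹ ≠ ∞ := ENNReal.inv_ne_top.2 hq0
    have hA' := ENNReal.toReal_mono hqi hA
    obtain ⟨π, hπ, hle⟩ := exists_coupling_lintegral_cost_le hd hdlsc hβ Q S (T := s) fun f => by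
      set D := ∫ y, infConv (fun y => a * α y) d f y ∂S - ∫ x, f x ∂Q
      rcases le_or_gt D 0 with hD | hD
      · exact hD.trans hs0
      -- `l = D / C` maximizes `l D - C l² / 2`
      have := h (D / C) (by positivity) _ hβ f (ne_top_of_le_ne_top hqi hA)
      have h2 : C * (D / C) ^ 2 * ((∫⁻ y, powDiv q ((a * α y : ℝ≥0) : ℝ≥0∞) ∂S).toReal -
          (q⁻¹).toReal + 1 / 2) ≤ C * (D / C) ^ 2 * (1 / 2) :=
        mul_le_mul_of_nonneg_left (by linarith) (by positivity)
      have h3 : D / C * D - C * (D / C) ^ 2 * (1 / 2) = D ^ 2 / (2 * C) := by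
        field_simp; ring
      have h4 : D ^ 2 / (2 * C) ≤ k := by linarith
      rw [div_le_iff₀ (by positivity)] at h4
      exact Real.le_sqrt_of_sq_le (by linarith)
    refine (iInf₂_le π hπ).trans (le_trans (le_of_eq ?_) hle)
    rw [div_eq_mul_inv, mul_comm, ← haN, ← lintegral_const_mul' _ _ ENNReal.coe_ne_top]
    refine lintegral_congr fun z => ?_
    rw [ENNReal.coe_mul, mul_assoc]

end Duality

/-! ### From the dual form of the cost to the exponential inequality -/

lemma EReal_exponent_eq {c : ℝ} (hc : 0 < c) (u : ℝ) {b : ℝ≥0∞} (hb : b ≠ ∞) (a : ℝ≥0∞) :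
    (u : EReal) - (c : EReal) * ((a : EReal) - (b : EReal) + ((1 / 2 : ℝ) : EReal)) =
      if a = ∞ then ⊥ else ((u - c * (a.toReal - b.toReal + 1 / 2) : ℝ) : EReal) := by
  lift b to ℝ≥0 using hb
  have hbr : ((b : ℝ≥0∞) : EReal) = ((b : ℝ) : EReal) := rfl
  split_ifs with h
  · rw [h, hbr, EReal.coe_ennreal_top, EReal.top_sub_coe, EReal.top_add_coe,
      EReal.coe_mul_top_of_pos hc, EReal.sub_top]
  · lift a to ℝ≥0 using h
    have har : ((a : ℝ≥0∞) : EReal) = ((a : ℝ) : EReal) := rfl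
    rw [har, hbr]
    norm_cast

variable {E : Type*} [TopologicalSpace E] [PolishSpace E] [MeasurableSpace E] [BorelSpace E]
  {d : E → E → ℝ} {q : ℝ≥0∞} {C : ℝ} {P : Measure E} [IsProbabilityMeasure P]

/-- `weakCost_le_iff` with a right-hand side that may be infinite, in which case both sides hold
trivially. -/
lemma weakCost_le_klDiv_iff (hd : IsMetric d)
    (hdlsc : LowerSemicontinuous fun z : E × E => d z.1 z.2) (hq : 2 ≤ q) (hC : 0 < C)
    (Q₁ Q₂ : Measure E) [IsProbabilityMeasure Q₁] [IsProbabilityMeasure Q₂] (κ : ℝ≥0∞) :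
    weakCost q d Q₁ Q₂ ≤ (2 * ENNReal.ofReal C * κ) ^ (1 / 2 : ℝ) ↔
      (κ ≠ ∞ → ∀ l : ℝ, 0 < l → ∀ α : E → ℝ≥0, LowerSemicontinuous α → ∀ f : E →ᵇ ℝ,
        ∫⁻ y, powDiv q (α y) ∂Q₂ ≠ ∞ →
        l * (∫ y, infConv α d f y ∂Q₂ - ∫ x, f x ∂Q₁) -
          C * l ^ 2 * ((∫⁻ y, powDiv q (α y) ∂Q₂).toReal - (q⁻¹).toReal + 1 / 2) ≤
            κ.toReal) := by
  rcases eq_or_ne κ ∞ with rfl | hκ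
  · have h1 : 2 * ENNReal.ofReal C * ∞ = ∞ := ENNReal.mul_top (by simp [hC])
    simp [h1]
  · rw [← weakCost_le_iff hd hdlsc hq hC Q₁ Q₂ ENNReal.toReal_nonneg, ENNReal.ofReal_toReal hκ]
    simp [hκ]

theorem weakTransportIneq_iff_dualForm (hd : IsMetric d)
    (hdlsc : LowerSemicontinuous fun z : E × E => d z.1 z.2) (hq : 2 ≤ q) (hC : 0 < C) :
    WeakTransportIneq q d C P ↔ DualForm q d C P := by
  have hqi : q⁻¹ ≠ ∞ := ENNReal.inv_ne_top.2 (two_pos.trans_le hq).ne'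
  have hdm := hdlsc.measurable
  -- Gibbs' principle for fixed `l`, `α` and `f`
  have key : ∀ l : ℝ, 0 < l → ∀ α : E → ℝ≥0, LowerSemicontinuous α → ∀ f : E →ᵇ ℝ,
      (∫⁻ y, EReal.exp (((l * (infConv α d f y - ∫ x, f x ∂P) : ℝ) : EReal) -
        ((C * l ^ 2 : ℝ) : EReal) *
        ((powDiv q (α y) : EReal) - ((q⁻¹ : ℝ≥0∞) : EReal) + ((1 / 2 : ℝ) : EReal))) ∂P ≤ 1 ↔
      ∀ Q : Measure E, IsProbabilityMeasure Q → klDiv Q P ≠ ∞ →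
        ∫⁻ y, powDiv q (α y) ∂Q ≠ ∞ →
        l * (∫ y, infConv α d f y ∂Q - ∫ x, f x ∂P) -
          C * l ^ 2 * ((∫⁻ y, powDiv q (α y) ∂Q).toReal - (q⁻¹).toReal + 1 / 2) ≤
            (klDiv Q P).toReal) := by
    intro l hl α hα f
    have hc : 0 < C * l ^ 2 := by positivity
    simp only [EReal_exponent_eq hc _ hqi]
    set m := ∫ x, f x ∂P
    let u : E → ℝ := fun y => l * (infConv α d f y - m)
    let φ : E → EReal := fun y => if powDiv q (α y) = ∞ then ⊥ else
      ((u y - C * l ^ 2 * ((powDiv q (α y)).toReal - (q⁻¹).toReal + 1 / 2) : ℝ) : EReal)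
    have hpow : Measurable fun y => powDiv q (α y) :=
      (measurable_powDiv q).comp hα.measurable.coe_nnreal_ennreal
    have hφ : AEMeasurable φ P := by
      have hΦ : Measurable fun z : ℝ × ℝ≥0∞ => if z.2 = ∞ then (⊥ : EReal) else
          ((l * (z.1 - m) - C * l ^ 2 * (z.2.toReal - (q⁻¹).toReal + 1 / 2) : ℝ) : EReal) :=
        Measurable.ite (measurable_snd (measurableSet_singleton ∞)) measurable_const
          (measurable_coe_real_ereal.comp (by fun_prop))
      exact hΦ.comp_aemeasurable
        ((aemeasurable_infConv hd.nonneg hdm hα.measurable f P).prodMk hpow.aemeasurable)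
    have hu : ∀ Q : Measure E, IsProbabilityMeasure Q → Integrable u Q := fun Q _ =>
      ((integrable_infConv hd hdm hα.measurable f Q).sub (integrable_const m)).const_mul l
    have hbot : ∀ y, φ y ≠ ⊥ ↔ powDiv q (α y) ≠ ∞ := fun y => by
      by_cases h : powDiv q (α y) = ∞
      · simp [φ, h]
      · simp only [φ, h, if_false, ne_eq, EReal.coe_ne_bot, not_false_eq_true]
    have hreal : ∀ y, powDiv q (α y) ≠ ∞ → (φ y).toReal =
        u y - C * l ^ 2 * ((powDiv q (α y)).toReal - (q⁻¹).toReal + 1 / 2) := fun y h => by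
      simp only [φ, h, if_false, EReal.toReal_coe]
    -- for which `Q` both sides of Gibbs' principle make sense, and the value of `Q[φ]`
    have hfin : ∀ Q : Measure E, IsProbabilityMeasure Q →
        ((∀ᵐ y ∂Q, φ y ≠ ⊥) ∧ Integrable (fun y => (φ y).toReal) Q ↔
          ∫⁻ y, powDiv q (α y) ∂Q ≠ ∞) := by
      intro Q hQ
      simp only [hbot]
      constructor
      · rintro ⟨h1, h2⟩
        rw [← integrable_toReal_iff hpow.aemeasurable h1]
        refine (((hu Q hQ).sub h2).const_mul (C * l ^ 2)⁻¹ |>.add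
          (integrable_const ((q⁻¹).toReal - 1 / 2))).congr ?_
        filter_upwards [h1] with y hy
        simp only [Pi.add_apply, Pi.sub_apply, hreal y hy]
        field_simp
        ring
      · intro h
        have h1 : ∀ᵐ y ∂Q, powDiv q (α y) ≠ ∞ := (ae_lt_top hpow h).mono fun _ hy => hy.ne
        refine ⟨h1, Integrable.congr (f := fun y =>
          u y - C * l ^ 2 * ((powDiv q (α y)).toReal - (q⁻¹).toReal + 1 / 2)) ?_ ?_⟩
        · have := (integrable_toReal_iff hpow.aemeasurable h1).2 h
          exact (hu Q hQ).sub
            (((this.sub (integrable_const _)).add (integrable_const _)).const_mul _)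
        · filter_upwards [h1] with y hy
          exact (hreal y hy).symm
    have hval : ∀ Q : Measure E, IsProbabilityMeasure Q → ∫⁻ y, powDiv q (α y) ∂Q ≠ ∞ →
        ∫ y, (φ y).toReal ∂Q = l * (∫ y, infConv α d f y ∂Q - m) -
          C * l ^ 2 * ((∫⁻ y, powDiv q (α y) ∂Q).toReal - (q⁻¹).toReal + 1 / 2) := by
      intro Q hQ h
      have hlt := ae_lt_top hpow h
      have h1 : ∀ᵐ y ∂Q, powDiv q (α y) ≠ ∞ := hlt.mono fun _ hy => hy.ne
      have hpi := (integrable_toReal_iff hpow.aemeasurable h1).2 h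
      have hpi' : Integrable (fun y => (powDiv q (α y)).toReal - (q⁻¹).toReal) Q :=
        hpi.sub (integrable_const _)
      have hpi'' : Integrable (fun y => C * l ^ 2 *
          ((powDiv q (α y)).toReal - (q⁻¹).toReal + 1 / 2)) Q :=
        (hpi'.add (integrable_const _)).const_mul _
      rw [integral_congr_ae (h1.mono fun y hy => hreal y hy), integral_sub (hu Q hQ) hpi'',
        integral_const_mul, integral_const_mul,
        integral_sub (integrable_infConv hd hdm hα.measurable f Q) (integrable_const m),
        integral_add hpi' (integrable_const _), integral_sub hpi (integrable_const _),
        integral_toReal hpow.aemeasurable hlt]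
      simp
    constructor
    · intro h Q hQ hK hA
      rw [← hval Q hQ hA]
      obtain ⟨h1, h2⟩ := (hfin Q hQ).2 hA
      exact integral_toReal_le_toReal_klDiv hφ h Q hK h1 h2
    · intro h
      refine lintegral_exp_le_one (φ := φ) hφ (M := l * (‖f‖ - m) + C * l ^ 2 * (q⁻¹).toReal)
        (fun y => ?_) fun Q hQ hK h1 h2 => ?_
      · by_cases hy : powDiv q (α y) = ∞
        · simp [φ, hy]
        simp only [φ, hy, if_false, EReal.coe_le_coe_iff]
        have h1 : infConv α d f y ≤ ‖f‖ :=
          (infConv_le hd f y).trans (abs_le.1 (f.norm_coe_le_norm y)).2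
        have h2 : u y ≤ l * (‖f‖ - m) := mul_le_mul_of_nonneg_left (by linarith) hl.le
        have h3 : 0 ≤ C * l ^ 2 * ((powDiv q (α y)).toReal + 1 / 2) := by positivity
        linarith
      · have hA := (hfin Q hQ).1 ⟨h1, h2⟩
        rw [hval Q hQ hA]
        exact h Q hQ hK hA
  constructor
  · intro h l hl α hα f
    rw [key l hl α hα f]
    exact fun Q hQ hK hA =>
      (weakCost_le_klDiv_iff hd hdlsc hq hC P Q _).1 (h Q hQ) hK l hl α hα f hA
  · intro h Q hQ
    rw [weakCost_le_klDiv_iff hd hdlsc hq hC P Q]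
    exact fun hK l hl α hα f hA => (key l hl α hα f).1 (h l hl α hα f) Q hQ hK hA

theorem invWeakTransportIneq_iff_invDualForm (hd : IsMetric d)
    (hdlsc : LowerSemicontinuous fun z : E × E => d z.1 z.2) (hq : 2 ≤ q) (hC : 0 < C) :
    InvWeakTransportIneq q d C P ↔ InvDualForm q d C P := by
  have hqi : q⁻¹ ≠ ∞ := ENNReal.inv_ne_top.2 (two_pos.trans_le hq).ne'
  -- Gibbs' principle for fixed `l`, `α` and `f`
  have key : ∀ l : ℝ, 0 < l → ∀ α : E → ℝ≥0, ∀ f : E →ᵇ ℝ,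
      (∫⁻ x, EReal.exp (((l * ((∫ y, infConv α d f y ∂P) - f x) : ℝ) : EReal) -
        ((C * l ^ 2 : ℝ) : EReal) *
        (((∫⁻ y, powDiv q (α y) ∂P : ℝ≥0∞) : EReal) - ((q⁻¹ : ℝ≥0∞) : EReal) +
          ((1 / 2 : ℝ) : EReal))) ∂P ≤ 1 ↔
      ∀ Q : Measure E, IsProbabilityMeasure Q → klDiv Q P ≠ ∞ →
        ∫⁻ y, powDiv q (α y) ∂P ≠ ∞ →
        l * (∫ y, infConv α d f y ∂P - ∫ x, f x ∂Q) -
          C * l ^ 2 * ((∫⁻ y, powDiv q (α y) ∂P).toReal - (q⁻¹).toReal + 1 / 2) ≤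
            (klDiv Q P).toReal) := by
    intro l hl α f
    simp only [EReal_exponent_eq (show 0 < C * l ^ 2 by positivity) _ hqi]
    rcases eq_or_ne (∫⁻ y, powDiv q (α y) ∂P) ∞ with hA | hA
    · simp [hA]
    simp only [hA, if_false, ne_eq, not_false_eq_true, true_imp_iff]
    set m := ∫ y, infConv α d f y ∂P
    set r := C * l ^ 2 * ((∫⁻ y, powDiv q (α y) ∂P).toReal - (q⁻¹).toReal + 1 / 2)
    have hφ : Measurable fun x => ((l * (m - f x) - r : ℝ) : EReal) :=
      measurable_coe_real_ereal.comp
        (((measurable_const.sub f.continuous.measurable).const_mul l).sub_const r)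
    have hint : ∀ Q : Measure E, IsProbabilityMeasure Q →
        Integrable (fun x => l * (m - f x)) Q := fun Q _ =>
      ((integrable_const m).sub (f.integrable Q)).const_mul l
    have hval : ∀ Q : Measure E, IsProbabilityMeasure Q →
        ∫ x, (((l * (m - f x) - r : ℝ) : EReal)).toReal ∂Q = l * (m - ∫ x, f x ∂Q) - r := by
      intro Q hQ
      simp only [EReal.toReal_coe]
      rw [integral_sub (hint Q hQ) (integrable_const r), integral_const_mul,
        integral_sub (integrable_const m) (f.integrable Q)]
      simp
    constructor
    · intro h Q hQ hK
      rw [← hval Q hQ]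
      refine integral_toReal_le_toReal_klDiv hφ.aemeasurable h Q hK
        (ae_of_all _ fun x => EReal.coe_ne_bot _) ?_
      simp only [EReal.toReal_coe]
      exact (hint Q hQ).sub (integrable_const r)
    · intro h
      refine lintegral_exp_le_one (φ := fun x => ((l * (m - f x) - r : ℝ) : EReal))
        hφ.aemeasurable (M := l * (m + ‖f‖) - r) (fun x => ?_) fun Q hQ hK _ _ => ?_
      · rw [EReal.coe_le_coe_iff]
        have h1 := (abs_le.1 (f.norm_coe_le_norm x)).1
        have h2 : l * (m - f x) ≤ l * (m + ‖f‖) := mul_le_mul_of_nonneg_left (by linarith) hl.le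
        linarith
      · rw [hval Q hQ]
        exact h Q hQ hK
  constructor
  · intro h l hl α hα f
    rw [key l hl α f]
    exact fun Q hQ hK hA =>
      (weakCost_le_klDiv_iff hd hdlsc hq hC Q P _).1 (h Q hQ) hK l hl α hα f hA
  · intro h Q hQ
    rw [weakCost_le_klDiv_iff hd hdlsc hq hC Q P]
    exact fun hK l hl α hα f hA => (key l hl α f).1 (h l hl α hα f) Q hQ hK hA

/-- An exponent conjugate to some `p ≤ 2` is at least `2`. -/
lemma two_le_of_inv_add_inv_eq_one {p q : ℝ≥0∞} (hp : p ≤ 2) (hpq : p⁻¹ + q⁻¹ = 1) : 2 ≤ q := by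
  have h1 : (2 : ℝ≥0∞)⁻¹ ≤ p⁻¹ := ENNReal.inv_le_inv.2 hp
  have h2 : (2 : ℝ≥0∞)⁻¹ + q⁻¹ ≤ 2⁻¹ + 2⁻¹ := by
    rw [ENNReal.inv_two_add_inv_two, ← hpq]
    gcongr
  exact ENNReal.inv_le_inv.1 ((ENNReal.add_le_add_iff_left (by simp)).1 h2)

end WeakTransport

theorem mainTheorem2 {E : Type*} [TopologicalSpace E] [PolishSpace E] [MeasurableSpace E]
    [BorelSpace E] (d : E → E → ℝ) (hd : WeakTransport.IsMetric d)
    (hdlsc : LowerSemicontinuous (fun z : E × E => d z.1 z.2))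
    (p q : ℝ≥0∞) (hp1 : 1 ≤ p) (hp2 : p ≤ 2) (hpq : p⁻¹ + q⁻¹ = 1)
    (C : ℝ) (hC : 0 < C) (P : Measure E) [IsProbabilityMeasure P] :
    (WeakTransport.WeakTransportIneq q d C P ↔ WeakTransport.DualForm q d C P) ∧
    (WeakTransport.InvWeakTransportIneq q d C P ↔ WeakTransport.InvDualForm q d C P) := by
  have hq : 2 ≤ q := WeakTransport.two_le_of_inv_add_inv_eq_one hp2 hpq
  exact ⟨WeakTransport.weakTransportIneq_iff_dualForm hd hdlsc hq hC,
    WeakTransport.invWeakTransportIneq_iff_invDualForm hd hdlsc hq hC⟩
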